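/- Let $A$ be a finite set of monadic predicate symbols. A (monadic) model is a pair $\mathbb D=(D,V)$ with $D$ a possibly empty set and $V:A\to\wp(D)$. Let $\mathrm{FOE}^\infty(A)$ be the set of formulas built from $\top,\bot,a(x),\neg a(x),x\approx y,x\not\approx y$ ($a\in A$, $x,y$ from a countably infinite set of variables) by $\lor,\land,\exists x,\forall x,\exists^\infty x,\forall^\infty x$, where $\exists^\infty$ means "for infinitely many" and $\forall^\infty$ "for all but finitely many"; $\mathrm{FOE}(A)$ is the fragment without $\exists^\infty,\forall^\infty$, and $\mathrm M(A)$ the fragment of $\mathrm{FOE}(A)$ without $\approx,\not\approx$. Truth of sentences is standard; in the empty model, sentences $\exists x.\varphi$ and $\exists^\infty x.\varphi$ are false, and $\forall x.\varphi$ and $\forall^\infty x.\varphi$ are true. Two sentences are equivalent if they are true in the same models. A model $(D',V')$ is a quotient of $(D,V)$ if there is a surjection $f:D\to D'$ with $d\in V(a)\iff f(d)\in V'(a)$ for all $a\in A$, $d\in D$. A sentence is invariant under taking quotients if it has the same truth value in $\mathbb D$ and in $\mathbb D'$ whenever $\mathbb D'$ is a quotient of $\mathbb D$. Let $L\in\{\mathrm{FOE},\mathrm{FOE}^\infty\}$.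 Then: 1. A sentence $\varphi$ of $L(A)$ is invariant under taking quotients if and only if it is equivalent to some sentence of $\mathrm M(A)$. 2. There is an effectively computable translation $\varphi\mapsto\varphi^\ast$ from the sentences of $L(A)$ to the sentences of $\mathrm M(A)$ such that, for every sentence $\varphi$ of $L(A)$, (i) for every model $(D,V)$, $(D,V)\models\varphi^\ast$ if and only if $(D\times\omega,V_\pi)\models\varphi$, where $V_\pi(a)=\{(d,k)\mid d\in V(a),\ k\in\omega\}$; and (ii) $\varphi$ is invariant under taking quotients if and only if $\varphi$ is equivalent to $\varphi^\ast$. 3. It is decidable whether a given sentence $\varphi$ of $L(A)$ is invariant under taking quotients. -/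

import Mathlib

universe u v

namespace MonadicLogic

/-- Monadic formulas (in negation normal form) over the set `A` of monadic predicate symbols, with
the individual variables numbered by `ℕ`. This is the full language `FOE∞(A)`. -/
inductive Formula (A : Type v) : Type v
  | top : Formula A
  | bot : Formula A
  | pred (a : A) (x : ℕ) : Formula A
  | npred (a : A) (x : ℕ) : Formula A
  | eq (x y : ℕ) : Formula A
  | neq (x y : ℕ) : Formula A
  | or (φ ψ : Formula A) : Formula A
  | and (φ ψ : Formula A) : Formula A
  | ex (x : ℕ) (φ : Formula A) : Formula A
  | all (x : ℕ) (φ : Formula A) : Formula A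
  | exInf (x : ℕ) (φ : Formula A) : Formula A
  | allInf (x : ℕ) (φ : Formula A) : Formula A

/-- The three monadic languages: first-order logic without equality, first-order logic with
equality, and first-order logic with equality and the infinity quantifiers. -/
inductive Logic : Type
  | M
  | FOE
  | FOEinf

/-- The language `L` has the (in)equality atoms. -/
def Logic.hasEq : Logic → Prop
  | .M => False
  | .FOE => True
  | .FOEinf => True

/-- The language `L` has the quantifiers "infinitely many" and "all but finitely many". -/
def Logic.hasInf : Logic → Prop
  | .M => False
  | .FOE => False
  | .FOEinf => True

namespace Formula

variable {A : Type v}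

/-- `φ.IsIn L`: the formula `φ` belongs to the language `L(A)`. -/
def IsIn (L : Logic) : Formula A → Prop
  | top => True
  | bot => True
  | pred _ _ => True
  | npred _ _ => True
  | eq _ _ => L.hasEq
  | neq _ _ => L.hasEq
  | or φ ψ => φ.IsIn L ∧ ψ.IsIn L
  | and φ ψ => φ.IsIn L ∧ ψ.IsIn L
  | ex _ φ => φ.IsIn L
  | all _ φ => φ.IsIn L
  | exInf _ φ => L.hasInf ∧ φ.IsIn L
  | allInf _ φ => L.hasInf ∧ φ.IsIn L

/-- The free variables of a formula. -/
def freeVars : Formula A → Finset ℕ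
  | top => ∅
  | bot => ∅
  | pred _ x => {x}
  | npred _ x => {x}
  | eq x y => {x, y}
  | neq x y => {x, y}
  | or φ ψ => φ.freeVars ∪ ψ.freeVars
  | and φ ψ => φ.freeVars ∪ ψ.freeVars
  | ex x φ => φ.freeVars.erase x
  | all x φ => φ.freeVars.erase x
  | exInf x φ => φ.freeVars.erase x
  | allInf x φ => φ.freeVars.erase x

/-- The Gödel number of a formula, relative to a numbering of the predicate symbols. -/
def code [Encodable A] : Formula A → ℕ
  | top => Nat.pair 0 0
  | bot => Nat.pair 1 0
  | pred a x => Nat.pair 2 (Nat.pair (Encodable.encode a) x)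
  | npred a x => Nat.pair 3 (Nat.pair (Encodable.encode a) x)
  | eq x y => Nat.pair 4 (Nat.pair x y)
  | neq x y => Nat.pair 5 (Nat.pair x y)
  | or φ ψ => Nat.pair 6 (Nat.pair φ.code ψ.code)
  | and φ ψ => Nat.pair 7 (Nat.pair φ.code ψ.code)
  | ex x φ => Nat.pair 8 (Nat.pair x φ.code)
  | all x φ => Nat.pair 9 (Nat.pair x φ.code)
  | exInf x φ => Nat.pair 10 (Nat.pair x φ.code)
  | allInf x φ => Nat.pair 11 (Nat.pair x φ.code)

theorem code_injective [Encodable A] : Function.Injective (code : Formula A → ℕ) := by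
  intro φ
  induction φ with
  | or φ ψ ih₁ ih₂ | and φ ψ ih₁ ih₂ =>
    intro χ h
    cases χ <;> simp [code, Nat.pair_eq_pair] at h
    rw [ih₁ h.1, ih₂ h.2]
  | ex x φ ih | all x φ ih | exInf x φ ih | allInf x φ ih =>
    intro χ h
    cases χ <;> simp [code, Nat.pair_eq_pair] at h
    rw [h.1, ih h.2]
  | _ =>
    intro χ h
    cases χ <;> simp_all [code, Nat.pair_eq_pair]

end Formula

/-- A monadic model: a (possibly empty) domain with a valuation of the predicate symbols. -/
structure Model (A : Type v) : Type (max v (u + 1)) where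
  Dom : Type u
  val : A → Set Dom

namespace Model

variable {A : Type v}

/-- Truth of a formula in a model under an assignment of the individual variables. -/
def Sat (D : Model.{u} A) : (ℕ → D.Dom) → Formula A → Prop
  | _, .top => True
  | _, .bot => False
  | g, .pred a x => g x ∈ D.val a
  | g, .npred a x => g x ∉ D.val a
  | g, .eq x y => g x = g y
  | g, .neq x y => g x ≠ g y
  | g, .or φ ψ => D.Sat g φ ∨ D.Sat g ψ
  | g, .and φ ψ => D.Sat g φ ∧ D.Sat g ψ
  | g, .ex x φ => ∃ d, D.Sat (Function.update g x d) φ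
  | g, .all x φ => ∀ d, D.Sat (Function.update g x d) φ
  | g, .exInf x φ => {d | D.Sat (Function.update g x d) φ}.Infinite
  | g, .allInf x φ => {d | ¬ D.Sat (Function.update g x d) φ}.Finite

end Model

/-- Truth of a sentence in the empty model: existential sentences are false, universal ones true.
Atoms do not occur outside the scope of a quantifier in a sentence, so that the value given to them
here is irrelevant. -/
def Formula.TrueInEmpty {A : Type v} : Formula A → Prop
  | .top => True
  | .bot => False
  | .pred _ _ => False
  | .npred _ _ => False
  | .eq _ _ => False
  | .neq _ _ => False
  | .or φ ψ => φ.TrueInEmpty ∨ ψ.TrueInEmpty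
  | .and φ ψ => φ.TrueInEmpty ∧ ψ.TrueInEmpty
  | .ex _ _ => False
  | .all _ _ => True
  | .exInf _ _ => False
  | .allInf _ _ => True

/-- The sentences of the language `L(A)`. -/
def Sentence (L : Logic) (A : Type v) : Type v :=
  {φ : Formula A // φ.IsIn L ∧ φ.freeVars = ∅}

/-- The Gödel number of a sentence. -/
def Sentence.code {L : Logic} {A : Type v} [Encodable A] (φ : Sentence L A) : ℕ :=
  φ.1.code

namespace Model

variable {A : Type v}

/-- Truth of a sentence in a model. If the domain is empty there are no assignments, and the second
conjunct holds vacuously; otherwise the first one does. -/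
def Truth (D : Model.{u} A) {L : Logic} (φ : Sentence L A) : Prop :=
  (IsEmpty D.Dom → φ.1.TrueInEmpty) ∧ ∀ g : ℕ → D.Dom, D.Sat g φ.1

/-- (Strong) homomorphisms of monadic models. -/
def IsHom (D D' : Model.{u} A) (f : D.Dom → D'.Dom) : Prop :=
  ∀ (a : A) (d : D.Dom), d ∈ D.val a ↔ f d ∈ D'.val a

/-- `D'` is a quotient of `D`. -/
def IsQuotientOf (D' D : Model.{u} A) : Prop :=
  ∃ f : D.Dom → D'.Dom, IsHom D D' f ∧ Function.Surjective f

/-- The `ω`-product of a model: every element is replaced by `ω` many copies of itself. -/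
def omegaProd (D : Model.{u} A) : Model.{u} A where
  Dom := D.Dom × ℕ
  val a := {p | p.1 ∈ D.val a}

end Model

namespace Sentence

variable {A : Type v} {L L' : Logic}

/-- Invariance under taking quotients. -/
def QuotientInvariant (φ : Sentence L A) : Prop :=
  ∀ D D' : Model.{u} A, D'.IsQuotientOf D → (D.Truth φ ↔ D'.Truth φ)

/-- Equivalence of sentences: truth in the same models. -/
def Equivalent (φ : Sentence L A) (ψ : Sentence L' A) : Prop :=
  ∀ D : Model.{u} A, D.Truth φ ↔ D.Truth ψ

end Sentence

/-- A translation of sentences is effective if it is computable on Gödel numbers. -/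
def Effective {A : Type v} [Encodable A] {L L' : Logic} (t : Sentence L A → Sentence L' A) : Prop :=
  ∃ f : ℕ → ℕ, Computable f ∧ ∀ φ : Sentence L A, f φ.code = (t φ).code

/-- A property of `L`-sentences is decidable if the set of the Gödel numbers of the `L`-sentences
that have it is computable. -/
def DecidableProperty {A : Type v} [Encodable A] {L : Logic} (P : Sentence L A → Prop) : Prop :=
  ComputablePred fun n : ℕ => ∃ φ : Sentence L A, φ.code = n ∧ P φ

end MonadicLogic

/-!
The `ω`-product `D × ω` of a model `D` depends, up to elementary equivalence, only on the set of
types (subsets of `A`) that are realised in `D`: each type occurs in it either never or infinitely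
often. As `A` is finite, every set of sets of types is defined by a sentence of `M(A)`
(`mDefinable_support_mem`), so that "`φ` holds in `D × ω`" is expressed by a sentence `φ*` of `M(A)`
(`exists_translation`). Sentences of `M(A)` are invariant under quotients, and `D` is a quotient of
`D × ω`; hence `φ` is invariant if and only if it has the same truth value in `D` and `D × ω` for
all `D`, that is, if and only if it is equivalent to `φ*` (`Sentence.quotientInvariant_iff`).

The effective part rests on an Ehrenfeucht-Fraïssé argument (`IsEvaluator.eval_iff_truth`). Let `q`
exceed the quantifier depth of `φ`; the Gödel number of `φ` plus one will do. The truth value of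
`φ` in `D` is determined by the *profile* of `D`: the number of elements of each type, where finite
numbers above `q` are cut down to `q` and infinity is recorded separately. It is calculated on a
finite domain which represents an infinite type by `q + 1` elements that carry a flag, by an
evaluator that reads "infinitely many" as "some flagged element that is not yet the value of a
variable". The evaluator is a recursion of and-or type on Gödel numbers and variable assignments,
hence primitive recursive (`exists_primrec_alternating`). The translation is computable because
`φ*` is determined by the values of the evaluator on the finitely many profiles of `ω`-products.
Invariance is decidable because it suffices to compare, for each of the finitely many profiles, the
value of the evaluator on the profile with its value on the profile of the `ω`-product; the numbers
that are Gödel numbers of sentences are recognised by another recursion of and-or type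
(`exists_primrec_check`).
-/

namespace MonadicLogic

/-! ### Recursion on and-or trees -/

/-- Recursion on and-or trees: if every node `s` has a primitive recursive list of children of
smaller measure and is, primitive recursively, labelled as a conjunction or a disjunction, then the
value of the nodes is primitive recursive. Leaves labelled as conjunctions are true, those labelled
as disjunctions are false. -/
theorem exists_primrec_alternating {σ : Type*} [Primcodable σ] (μ : σ → ℕ) (conj : σ → Bool)
    (children : σ → List σ) (hμ : Primrec μ) (hconj : Primrec conj) (hchildren : Primrec children)
    (hlt : ∀ s, ∀ s' ∈ children s, μ s' < μ s) :
    ∃ f : σ → Bool, Primrec f ∧ ∀ s, f s = true ↔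
      bif conj s then ∀ s' ∈ children s, f s' = true else ∃ s' ∈ children s, f s' = true := by
  classical
  let f : σ → Bool := WellFounded.fix (measure μ).wf fun s ih => decide
    (bif conj s then ∀ s' : {s' // s' ∈ children s}, ih s'.1 (hlt s s'.1 s'.2) = true
      else ∃ s' : {s' // s' ∈ children s}, ih s'.1 (hlt s s'.1 s'.2) = true)
  have hf : ∀ s, f s = true ↔
      bif conj s then ∀ s' ∈ children s, f s' = true else ∃ s' ∈ children s, f s' = true := by
    intro s
    simp only [f]
    rw [WellFounded.fix_eq]
    cases conj s <;> simp
  refine ⟨f, ?_, hf⟩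
  refine Primrec.nat_omega_rec' f (m := μ) (l := children)
    (g := fun s vs => some (bif conj s then decide (∀ b ∈ vs, b = true)
      else decide (∃ b ∈ vs, b = true))) hμ hchildren ?_ hlt ?_
  · have hb : PrimrecPred fun b : Bool => b = true :=
      Primrec.eq.comp Primrec.id (Primrec.const true)
    exact Primrec.option_some.comp (Primrec.cond (hconj.comp Primrec.fst)
      (hb.forall_mem_list.decide.comp Primrec.snd) (hb.exists_mem_list.decide.comp Primrec.snd))
  · intro s
    congr 1
    rw [Bool.eq_iff_iff, hf s]
    cases conj s <;> simp

/-! ### Evaluation of Gödel numbers on finite domains -/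

/-- Elements of the finite domains on which formulas are evaluated: the index of the type of the
element, a flag which says that the type has infinitely many elements in the model represented by
the domain, and a number that distinguishes the elements of the same type. -/
abbrev Elem : Type := ℕ × Bool × ℕ

/-- The arguments of the evaluator: a domain, the Gödel number of a formula, and an assignment of
elements to finitely many variables, where earlier entries take precedence over later ones. -/
abbrev EvalState : Type := List Elem × ℕ × List (ℕ × Elem)

namespace EvalState

/-- The first component of the Gödel number, which determines the outermost symbol. -/
def tag (s : EvalState) : ℕ := s.2.1.unpair.1
/-- The first argument of the outermost symbol: a predicate symbol, a variable, or a formula. -/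
def left (s : EvalState) : ℕ := s.2.1.unpair.2.unpair.1
/-- The second argument of the outermost symbol: a variable or a formula. -/
def right (s : EvalState) : ℕ := s.2.1.unpair.2.unpair.2

/-- The value of the atom `pred`. The function `tab` says, in terms of their numbers, which
predicate symbols belong to which types. An unassigned variable, which does not occur in the
evaluation of a sentence, satisfies no predicate. -/
def predValue (tab : ℕ → ℕ → Bool) (s : EvalState) : Bool :=
  ((s.2.2.lookup s.right).map fun e => tab s.left e.1).getD false

/-- Whether the state is evaluated as the conjunction or as the disjunction of its children. Atoms
have no children, so that for them this is the truth value itself. -/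
def conj (tab : ℕ → ℕ → Bool) (s : EvalState) : Bool :=
  if s.tag = 1 then false
  else if s.tag = 2 then predValue tab s
  else if s.tag = 3 then !predValue tab s
  else if s.tag = 4 then decide (s.2.2.lookup s.left = s.2.2.lookup s.right)
  else if s.tag = 5 then !decide (s.2.2.lookup s.left = s.2.2.lookup s.right)
  else if s.tag = 6 then false
  else if s.tag = 8 then false
  else if s.tag = 10 then false
  else true

/-- The state obtained from that of a quantified formula by choosing the value `e` of the bound
variable. -/
def extend (s : EvalState) (e : Elem) : EvalState := (s.1, s.right, (s.left, e) :: s.2.2)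

/-- The states on which the value of `s` depends. The values of the bound variable of an infinity
quantifier range over the flagged elements which are not in the assignment. -/
def children (s : EvalState) : List EvalState :=
  if s.tag = 6 ∨ s.tag = 7 then [(s.1, s.left, s.2.2), (s.1, s.right, s.2.2)]
  else if s.tag = 8 ∨ s.tag = 9 then s.1.map s.extend
  else if s.tag = 10 ∨ s.tag = 11 then
    (s.1.filter fun e => e.2.1 = true ∧ e ∉ s.2.2.map Prod.snd).map s.extend
  else []

open Primrec in
theorem primrec_tag : Primrec tag := fst.comp (unpair.comp (fst.comp snd))
open Primrec in
theorem primrec_left : Primrec left :=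
  fst.comp (unpair.comp (snd.comp (unpair.comp (fst.comp snd))))
open Primrec in
theorem primrec_right : Primrec right :=
  snd.comp (unpair.comp (snd.comp (unpair.comp (fst.comp snd))))

theorem primrecPred_tag_eq (k : ℕ) : PrimrecPred fun s : EvalState => s.tag = k :=
  Primrec.eq.comp primrec_tag (Primrec.const k)

open Primrec in
theorem primrec_conj {tab : ℕ → ℕ → Bool} (htab : Primrec₂ tab) : Primrec (conj tab) := by
  have henv : Primrec fun s : EvalState => s.2.2 := snd.comp snd
  have hpred : Primrec (predValue tab) :=
    option_getD.comp (option_map (listLookup.comp primrec_right henv)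
      (htab.comp (primrec_left.comp fst) (fst.comp snd))) (const false)
  have heq : Primrec fun s : EvalState => decide (s.2.2.lookup s.left = s.2.2.lookup s.right) :=
    PrimrecPred.decide (Primrec.eq.comp (listLookup.comp primrec_left henv)
      (listLookup.comp primrec_right henv))
  exact ite (primrecPred_tag_eq _) (const _) <| ite (primrecPred_tag_eq _) hpred <|
    ite (primrecPred_tag_eq _) (Primrec.not.comp hpred) <| ite (primrecPred_tag_eq _) heq <|
    ite (primrecPred_tag_eq _) (Primrec.not.comp heq) <| ite (primrecPred_tag_eq _) (const _) <|
    ite (primrecPred_tag_eq _) (const _) <| ite (primrecPred_tag_eq _) (const _) (const _)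

open Primrec in
theorem primrec_children : Primrec children := by
  have henv : Primrec fun s : EvalState => s.2.2 := snd.comp snd
  have hext : Primrec₂ extend :=
    pair (fst.comp fst) (pair (primrec_right.comp fst)
      (list_cons.comp (pair (primrec_left.comp fst) snd) (henv.comp fst)))
  have hne : PrimrecRel fun (e' e : Elem) => e' ≠ e := PrimrecPred.not Primrec.eq
  have hfresh : PrimrecRel fun (e : Elem) (env : List Elem) =>
      e.2.1 = true ∧ e ∉ env :=
    PrimrecPred.of_eq (p := fun q : Elem × List Elem => q.1.2.1 = true ∧ ∀ e' ∈ q.2, e' ≠ q.1)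
    (PrimrecPred.and (Primrec.eq.comp (fst.comp (snd.comp fst)) (const true))
      (hne.forall_mem_list.comp snd fst)) fun q => by grind
  exact ite ((primrecPred_tag_eq _).or (primrecPred_tag_eq _))
    (list_cons.comp (pair fst (pair primrec_left henv))
      (list_cons.comp (pair fst (pair primrec_right henv)) (const []))) <|
    ite ((primrecPred_tag_eq _).or (primrecPred_tag_eq _)) (list_map fst hext) <|
    ite ((primrecPred_tag_eq _).or (primrecPred_tag_eq _))
      (list_map (hfresh.listFilter.comp fst (list_map henv (snd.comp snd))) hext) (const _)

end EvalState

theorem unpair_unpair_lt {n : ℕ} (h : 0 < n.unpair.1) :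
    n.unpair.2.unpair.1 < n ∧ n.unpair.2.unpair.2 < n := by
  have h1 := Nat.unpair_add_le n
  have h2 := Nat.unpair_left_le n.unpair.2
  have h3 := Nat.unpair_right_le n.unpair.2
  omega

theorem EvalState.lt_of_mem_children {s s' : EvalState} (h : s' ∈ s.children) :
    s'.2.1 < s.2.1 := by
  have key := @unpair_unpair_lt s.2.1
  unfold children at h
  split_ifs at h with h1 h2 h3
  · have := key (by unfold tag at h1; omega)
    simp only [List.mem_cons, List.not_mem_nil, or_false] at h
    rcases h with rfl | rfl
    exacts [this.1, this.2]
  · have := key (by unfold tag at h2; omega)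
    obtain ⟨e, -, rfl⟩ := List.mem_map.1 h
    exact this.2
  · have := key (by unfold tag at h3; omega)
    obtain ⟨e, -, rfl⟩ := List.mem_map.1 h
    exact this.2
  · simp at h

/-- A primitive recursive evaluator of Gödel numbers of formulas on finite domains. -/
structure IsEvaluator (tab : ℕ → ℕ → Bool) (f : EvalState → Bool) : Prop where
  primrec : Primrec f
  eval : ∀ s : EvalState, f s = true ↔ bif s.conj tab then ∀ s' ∈ s.children, f s' = true
      else ∃ s' ∈ s.children, f s' = true

theorem exists_isEvaluator {tab : ℕ → ℕ → Bool} (htab : Primrec₂ tab) :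
    ∃ f, IsEvaluator tab f := by
  obtain ⟨f, h1, h2⟩ := exists_primrec_alternating (fun s : EvalState => s.2.1)
    (EvalState.conj tab) EvalState.children (Primrec.fst.comp Primrec.snd)
    (EvalState.primrec_conj htab) EvalState.primrec_children
    (fun s s' h => EvalState.lt_of_mem_children h)
  exact ⟨f, h1, h2⟩

theorem exists_mem_map_iff {α β : Type*} {g : α → β} {l : List α} {P : β → Prop} :
    (∃ b ∈ l.map g, P b) ↔ ∃ a ∈ l, P (g a) := by
  simp

namespace IsEvaluator

variable {A : Type v} [Encodable A] {tab : ℕ → ℕ → Bool} {f : EvalState → Bool}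
  (hf : IsEvaluator tab f) (dom : List Elem) (env : List (ℕ × Elem))

section
open EvalState Formula

set_option linter.unusedSimpArgs false

include hf

theorem eval_top :
    f (dom, (Formula.top : Formula A).code, env) = true := by
  rw [hf.eval]
  simp [conj, children, tag, Formula.code]

theorem eval_bot :
    ¬ f (dom, (Formula.bot : Formula A).code, env) = true := by
  rw [hf.eval]
  simp [conj, children, tag, Formula.code]

theorem eval_pred (a : A) (x : ℕ) :
    f (dom, (Formula.pred a x : Formula A).code, env) = true ↔
      ((env.lookup x).map fun e => tab (Encodable.encode a) e.1).getD false = true := by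
  rw [hf.eval]
  simp [conj, children, tag, left, right, Formula.code, predValue]

theorem eval_npred (a : A) (x : ℕ) :
    f (dom, (Formula.npred a x : Formula A).code, env) = true ↔
      ((env.lookup x).map fun e => tab (Encodable.encode a) e.1).getD false = false := by
  rw [hf.eval]
  simp [conj, children, tag, left, right, Formula.code, predValue]

theorem eval_eq (x y : ℕ) :
    f (dom, (Formula.eq x y : Formula A).code, env) = true ↔
      env.lookup x = env.lookup y := by
  rw [hf.eval]
  simp [conj, children, tag, left, right, Formula.code]

theorem eval_neq (x y : ℕ) :
    f (dom, (Formula.neq x y : Formula A).code, env) = true ↔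
      env.lookup x ≠ env.lookup y := by
  rw [hf.eval]
  simp [conj, children, tag, left, right, Formula.code]

theorem eval_or (φ ψ : Formula A) :
    f (dom, (Formula.or φ ψ : Formula A).code, env) = true ↔
      f (dom, φ.code, env) = true ∨ f (dom, ψ.code, env) = true := by
  rw [hf.eval]
  simp [conj, children, tag, left, right, Formula.code]

theorem eval_and (φ ψ : Formula A) :
    f (dom, (Formula.and φ ψ : Formula A).code, env) = true ↔
      f (dom, φ.code, env) = true ∧ f (dom, ψ.code, env) = true := by
  rw [hf.eval]
  simp [conj, children, tag, left, right, Formula.code]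

theorem eval_ex (x : ℕ) (φ : Formula A) :
    f (dom, (Formula.ex x φ : Formula A).code, env) = true ↔
      ∃ e ∈ dom, f (dom, φ.code, (x, e) :: env) = true := by
  rw [hf.eval]
  simp only [conj, children, tag, left, right, extend, Formula.code, Nat.unpair_pair,
    List.forall_mem_map, exists_mem_map_iff, List.mem_filter, decide_eq_true_eq, and_assoc,
    and_imp, Nat.reduceEqDiff, OfNat.ofNat_ne_one, or_false, false_or, or_self, true_or, or_true,
    reduceIte, cond_true, cond_false]

theorem eval_all (x : ℕ) (φ : Formula A) :
    f (dom, (Formula.all x φ : Formula A).code, env) = true ↔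
      ∀ e ∈ dom, f (dom, φ.code, (x, e) :: env) = true := by
  rw [hf.eval]
  simp only [conj, children, tag, left, right, extend, Formula.code, Nat.unpair_pair,
    List.forall_mem_map, exists_mem_map_iff, List.mem_filter, decide_eq_true_eq, and_assoc,
    and_imp, Nat.reduceEqDiff, OfNat.ofNat_ne_one, or_false, false_or, or_self, true_or, or_true,
    reduceIte, cond_true, cond_false]

theorem eval_exInf (x : ℕ) (φ : Formula A) :
    f (dom, (Formula.exInf x φ : Formula A).code, env) = true ↔
      ∃ e ∈ dom, (e.2.1 = true ∧ e ∉ env.map Prod.snd) ∧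
        f (dom, φ.code, (x, e) :: env) = true := by
  rw [hf.eval]
  simp only [conj, children, tag, left, right, extend, Formula.code, Nat.unpair_pair,
    List.forall_mem_map, exists_mem_map_iff, List.mem_filter, decide_eq_true_eq, and_assoc,
    and_imp, Nat.reduceEqDiff, OfNat.ofNat_ne_one, or_false, false_or, or_self, true_or, or_true,
    reduceIte, cond_true, cond_false]

theorem eval_allInf (x : ℕ) (φ : Formula A) :
    f (dom, (Formula.allInf x φ : Formula A).code, env) = true ↔
      ∀ e ∈ dom, (e.2.1 = true ∧ e ∉ env.map Prod.snd) →
        f (dom, φ.code, (x, e) :: env) = true := by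
  rw [hf.eval]
  simp only [conj, children, tag, left, right, extend, Formula.code, Nat.unpair_pair,
    List.forall_mem_map, exists_mem_map_iff, List.mem_filter, decide_eq_true_eq, and_assoc,
    and_imp, Nat.reduceEqDiff, OfNat.ofNat_ne_one, or_false, false_or, or_self, true_or, or_true,
    reduceIte, cond_true, cond_false]

end

end IsEvaluator

/-! ### Recognition of Gödel numbers -/

/-- A number, to be tested for being the Gödel number of a formula, and a list of variables that
the formula may have free. -/
abbrev CheckState : Type := ℕ × List ℕ

namespace CheckState

/-- The first component of the number, which determines the outermost symbol. -/
def tag (s : CheckState) : ℕ := s.1.unpair.1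
/-- The second component of the number, which codes the arguments of the outermost symbol. -/
def payload (s : CheckState) : ℕ := s.1.unpair.2
/-- The first argument of the outermost symbol. -/
def left (s : CheckState) : ℕ := s.payload.unpair.1
/-- The second argument of the outermost symbol. -/
def right (s : CheckState) : ℕ := s.payload.unpair.2

/-- Whether the conditions on the outermost symbol and its arguments other than subformulas are
met; `preds` lists the numbers of the predicate symbols. -/
def conj (hasEq hasInf : Bool) (preds : List ℕ) (s : CheckState) : Bool :=
  if s.tag = 0 ∨ s.tag = 1 then decide (s.payload = 0)
  else if s.tag = 2 ∨ s.tag = 3 then decide (s.left ∈ preds ∧ s.right ∈ s.2)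
  else if s.tag = 4 ∨ s.tag = 5 then decide (hasEq = true ∧ s.left ∈ s.2 ∧ s.right ∈ s.2)
  else if s.tag = 10 ∨ s.tag = 11 then hasInf
  else decide (s.tag < 12)

/-- The states of the subformulas, which must all be accepted; none of them if the outermost symbol
does not belong to the language, so that the label alone decides. -/
def children (hasInf : Bool) (s : CheckState) : List CheckState :=
  if s.tag = 6 ∨ s.tag = 7 then [(s.left, s.2), (s.right, s.2)]
  else if s.tag = 8 ∨ s.tag = 9 then [(s.right, s.left :: s.2)]
  else if s.tag = 10 ∨ s.tag = 11 then bif hasInf then [(s.right, s.left :: s.2)] else []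
  else []

open Primrec in
theorem primrec_tag : Primrec tag := fst.comp (unpair.comp fst)
open Primrec in
theorem primrec_payload : Primrec payload := snd.comp (unpair.comp fst)
open Primrec in
theorem primrec_left : Primrec left := fst.comp (unpair.comp primrec_payload)
open Primrec in
theorem primrec_right : Primrec right := snd.comp (unpair.comp primrec_payload)

theorem primrecPred_tag_eq_or (j k : ℕ) :
    PrimrecPred fun s : CheckState => s.tag = j ∨ s.tag = k :=
  (Primrec.eq.comp primrec_tag (Primrec.const j)).or
    (Primrec.eq.comp primrec_tag (Primrec.const k))

theorem primrecRel_mem : PrimrecRel fun (x : ℕ) (l : List ℕ) => x ∈ l :=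
  PrimrecPred.of_eq (p := fun q : ℕ × List ℕ => ∃ y ∈ q.2, y = q.1)
    ((PrimrecRel.exists_mem_list Primrec.eq).comp Primrec.snd Primrec.fst) fun q => by simp

open Primrec in
theorem primrec_conj (hasEq hasInf : Bool) (preds : List ℕ) :
    Primrec (conj hasEq hasInf preds) := by
  have hl : PrimrecPred fun s : CheckState => s.left ∈ s.2 :=
    primrecRel_mem.comp primrec_left snd
  have hr : PrimrecPred fun s : CheckState => s.right ∈ s.2 :=
    primrecRel_mem.comp primrec_right snd
  have hp : PrimrecPred fun s : CheckState => s.left ∈ preds :=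
    primrecRel_mem.comp primrec_left (const preds)
  have he : PrimrecPred fun _ : CheckState => hasEq = true :=
    Primrec.eq.comp (const hasEq) (const true)
  exact ite (primrecPred_tag_eq_or _ _) (Primrec.eq.comp primrec_payload (const 0)).decide <|
    ite (primrecPred_tag_eq_or _ _) (hp.and hr).decide <|
    ite (primrecPred_tag_eq_or _ _) (he.and (hl.and hr)).decide <|
    ite (primrecPred_tag_eq_or _ _) (const _) (nat_lt.comp primrec_tag (const 12)).decide

open Primrec in
theorem primrec_children (hasInf : Bool) : Primrec (children hasInf) := by
  have hbind : Primrec fun s : CheckState => [(s.right, s.left :: s.2)] :=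
    list_cons.comp (pair primrec_right (list_cons.comp primrec_left snd)) (const [])
  exact ite (primrecPred_tag_eq_or _ _)
    (list_cons.comp (pair primrec_left snd)
      (list_cons.comp (pair primrec_right snd) (const []))) <|
    ite (primrecPred_tag_eq_or _ _) hbind <|
    ite (primrecPred_tag_eq_or _ _) (Primrec.cond (const _) hbind (const _)) (const _)

theorem lt_of_mem_children {hasInf : Bool} {s s' : CheckState} (h : s' ∈ s.children hasInf) :
    s'.1 < s.1 := by
  have key := @unpair_unpair_lt s.1
  unfold children at h
  split_ifs at h with h1 h2 h3
  · have := key (by unfold tag at h1; omega)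
    simp only [List.mem_cons, List.not_mem_nil, or_false] at h
    rcases h with rfl | rfl
    exacts [this.1, this.2]
  · have := key (by unfold tag at h2; omega)
    obtain rfl := List.mem_singleton.1 h
    exact this.2
  · have := key (by unfold tag at h3; omega)
    cases hasInf
    · simp at h
    · obtain rfl := List.mem_singleton.1 h
      exact this.2
  · simp at h

end CheckState

open CheckState in
/-- It is primitive recursive whether a number is the Gödel number of a formula of `L(A)` with free
variables in a given list. -/
theorem exists_primrec_check (L : Logic) (A : Type v) [Finite A] [Encodable A] :
    ∃ f : CheckState → Bool, Primrec f ∧ ∀ n bound, f (n, bound) = true ↔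
      ∃ φ : Formula A, φ.code = n ∧ φ.IsIn L ∧ φ.freeVars ⊆ bound.toFinset := by
  classical
  have hfin : (Set.range (Encodable.encode : A → ℕ)).Finite := Set.finite_range _
  let preds : List ℕ := hfin.toFinset.toList
  have hpreds : ∀ n, n ∈ preds ↔ ∃ a : A, Encodable.encode a = n := by simp [preds]
  let hE := decide L.hasEq
  let hI := decide L.hasInf
  obtain ⟨f, hf, hspec⟩ := exists_primrec_alternating (fun s : CheckState => s.1)
    (conj hE hI preds) (children hI) Primrec.fst (primrec_conj hE hI preds)
    (primrec_children hI) (fun s s' h => lt_of_mem_children h)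
  refine ⟨f, hf, fun n bound => ⟨?_, ?_⟩⟩
  · induction n using Nat.strong_induction_on generalizing bound with
    | _ n ih =>
      intro h
      rw [hspec] at h
      obtain ⟨t, m, rfl⟩ : ∃ t m, n = Nat.pair t m := ⟨_, _, (Nat.pair_unpair n).symm⟩
      obtain ⟨l, r, rfl⟩ : ∃ l r, m = Nat.pair l r := ⟨_, _, (Nat.pair_unpair m).symm⟩
      have hlt : 0 < t → l < Nat.pair t (Nat.pair l r) ∧ r < Nat.pair t (Nat.pair l r) := by
        intro ht
        have := @unpair_unpair_lt (Nat.pair t (Nat.pair l r)) (by simpa using ht)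
        simpa using this
      have ht : t < 12 := by
        by_contra ht
        simp [conj, children, tag, show t ≠ 0 by omega, show t ≠ 1 by omega,
          show t ≠ 2 by omega, show t ≠ 3 by omega, show t ≠ 4 by omega, show t ≠ 5 by omega,
          show t ≠ 6 by omega, show t ≠ 7 by omega, show t ≠ 8 by omega, show t ≠ 9 by omega,
          show t ≠ 10 by omega, show t ≠ 11 by omega, ht] at h
      interval_cases t
      · simp [conj, children, tag, payload] at h
        exact ⟨.top, by simp [Formula.code, h], trivial, by simp [Formula.freeVars]⟩
      · simp [conj, children, tag, payload] at h
        exact ⟨.bot, by simp [Formula.code, h], trivial, by simp [Formula.freeVars]⟩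
      · simp [conj, children, tag, payload, left, right, hpreds] at h
        obtain ⟨⟨a, rfl⟩, hx⟩ := h
        exact ⟨.pred a r, rfl, trivial, by simpa [Formula.freeVars] using hx⟩
      · simp [conj, children, tag, payload, left, right, hpreds] at h
        obtain ⟨⟨a, rfl⟩, hx⟩ := h
        exact ⟨.npred a r, rfl, trivial, by simpa [Formula.freeVars] using hx⟩
      · simp [conj, children, tag, payload, left, right, hE] at h
        exact ⟨.eq l r, rfl, h.1, by simpa [Formula.freeVars, Finset.insert_subset_iff] using h.2⟩
      · simp [conj, children, tag, payload, left, right, hE] at h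
        exact ⟨.neq l r, rfl, h.1, by simpa [Formula.freeVars, Finset.insert_subset_iff] using h.2⟩
      · simp [conj, children, tag, payload, left, right] at h
        obtain ⟨φ, rfl, h1, h2⟩ := ih _ (hlt (by simp)).1 _ h.1
        obtain ⟨ψ, rfl, h3, h4⟩ := ih _ (hlt (by simp)).2 _ h.2
        exact ⟨.or φ ψ, rfl, ⟨h1, h3⟩, Finset.union_subset h2 h4⟩
      · simp [conj, children, tag, payload, left, right] at h
        obtain ⟨φ, rfl, h1, h2⟩ := ih _ (hlt (by simp)).1 _ h.1
        obtain ⟨ψ, rfl, h3, h4⟩ := ih _ (hlt (by simp)).2 _ h.2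
        exact ⟨.and φ ψ, rfl, ⟨h1, h3⟩, Finset.union_subset h2 h4⟩
      · simp [conj, children, tag, payload, left, right] at h
        obtain ⟨φ, rfl, h1, h2⟩ := ih _ (hlt (by simp)).2 _ h
        exact ⟨.ex l φ, rfl, h1, by
          simpa [Formula.freeVars, ← Finset.subset_insert_iff] using h2⟩
      · simp [conj, children, tag, payload, left, right] at h
        obtain ⟨φ, rfl, h1, h2⟩ := ih _ (hlt (by simp)).2 _ h
        exact ⟨.all l φ, rfl, h1, by
          simpa [Formula.freeVars, ← Finset.subset_insert_iff] using h2⟩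
      · by_cases hi : L.hasInf <;>
          simp [conj, children, tag, payload, left, right, hI, hi] at h
        obtain ⟨φ, rfl, h1, h2⟩ := ih _ (hlt (by simp)).2 _ h
        exact ⟨.exInf l φ, rfl, ⟨hi, h1⟩, by
          simpa [Formula.freeVars, ← Finset.subset_insert_iff] using h2⟩
      · by_cases hi : L.hasInf <;>
          simp [conj, children, tag, payload, left, right, hI, hi] at h
        obtain ⟨φ, rfl, h1, h2⟩ := ih _ (hlt (by simp)).2 _ h
        exact ⟨.allInf l φ, rfl, ⟨hi, h1⟩, by
          simpa [Formula.freeVars, ← Finset.subset_insert_iff] using h2⟩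
  · rintro ⟨φ, rfl, hL, hfv⟩
    induction φ generalizing bound with
    | top | bot =>
      rw [hspec]
      simp [conj, children, tag, payload, Formula.code]
    | pred a x | npred a x =>
      rw [hspec]
      simpa [conj, children, tag, payload, left, right, Formula.code, hpreds,
        Formula.freeVars] using hfv
    | eq x y | neq x y =>
      rw [hspec]
      have hL' : L.hasEq := hL
      simpa [conj, children, tag, payload, left, right, Formula.code, hE, hL',
        Formula.freeVars, Finset.insert_subset_iff] using hfv
    | or φ ψ ih₁ ih₂ | and φ ψ ih₁ ih₂ =>
      rw [hspec]
      simp [conj, children, tag, payload, left, right, Formula.code,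
        ih₁ bound hL.1 (Finset.union_subset_left hfv),
        ih₂ bound hL.2 (Finset.union_subset_right hfv)]
    | ex x φ ih | all x φ ih =>
      rw [hspec]
      simp [conj, children, tag, payload, left, right, Formula.code]
      exact ih _ hL (by simpa [Formula.freeVars, ← Finset.subset_insert_iff] using hfv)
    | exInf x φ ih | allInf x φ ih =>
      rw [hspec]
      have hi : L.hasInf := hL.1
      simp [conj, children, tag, payload, left, right, Formula.code, hI, hi]
      exact ih _ hL.2 (by simpa [Formula.freeVars, ← Finset.subset_insert_iff] using hfv)

/-! ### The Ehrenfeucht-Fraïssé argument -/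

theorem exists_mem_notMem_iff_card_lt_encard {α : Type*} {F : Finset α} {S : Set α} (h : ↑F ⊆ S) :
    (∃ x ∈ S, x ∉ F) ↔ (F.card : ℕ∞) < S.encard := by
  rw [← Set.encard_coe_eq_coe_finsetCard]
  constructor
  · rintro ⟨x, hx, hxF⟩
    exact F.finite_toSet.encard_lt_encard ⟨h, fun hS => hxF (hS hx)⟩
  · intro hlt
    by_contra! hno
    exact absurd (Set.encard_le_encard (show S ⊆ ↑F from hno)) (not_le.2 hlt)

namespace Model

variable {A : Type v}

/-- The type of an element: the set of the predicates that it satisfies. -/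
def typeOf (D : Model.{u} A) (d : D.Dom) : Set A := {a | d ∈ D.val a}

/-- The finite domain `dom` represents the model `D`, with types numbered by `ι`, up to `q`: every
type has the same number of elements in both, where numbers from `q` on are not distinguished, and
the flags mark the elements of the types that are infinite in `D`. -/
structure Approximates (ι : Set A → ℕ) (D : Model.{u} A) (dom : List Elem) (q : ℕ) : Prop where
  count : ∀ j u : ℕ, u < q →
    ((u : ℕ∞) < {e | e ∈ dom ∧ e.1 = j}.encard ↔ (u : ℕ∞) < {d | ι (D.typeOf d) = j}.encard)
  inf : ∀ e ∈ dom, e.2.1 = true ↔ {d | ι (D.typeOf d) = e.1}.Infinite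

/-- A finite partial isomorphism between the domain and the model, given by its graph `Z`. -/
structure IsMatching (ι : Set A → ℕ) (D : Model.{u} A) (dom : List Elem)
    (Z : Finset (Elem × D.Dom)) : Prop where
  mem : ∀ p ∈ Z, p.1 ∈ dom
  type : ∀ p ∈ Z, ι (D.typeOf p.2) = p.1.1
  inj : ∀ p ∈ Z, ∀ p' ∈ Z, p.1 = p'.1 ↔ p.2 = p'.2

variable {ι : Set A → ℕ} {D : Model.{u} A} {dom : List Elem} {q : ℕ}
  {Z : Finset (Elem × D.Dom)}

theorem IsMatching.insert [DecidableEq (Elem × D.Dom)] (hZ : IsMatching ι D dom Z) {e : Elem}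
    {d : D.Dom} (he : e ∈ dom) (hd : ι (D.typeOf d) = e.1) (he' : ∀ p ∈ Z, p.1 ≠ e)
    (hd' : ∀ p ∈ Z, p.2 ≠ d) : IsMatching ι D dom (insert (e, d) Z) where
  mem := by
    intro p hp
    rcases Finset.mem_insert.1 hp with rfl | hp
    exacts [he, hZ.mem p hp]
  type := by
    intro p hp
    rcases Finset.mem_insert.1 hp with rfl | hp
    exacts [hd, hZ.type p hp]
  inj := by
    intro p hp p' hp'
    rcases Finset.mem_insert.1 hp with rfl | hp <;> rcases Finset.mem_insert.1 hp' with rfl | hp'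
    · simp
    · exact iff_of_false (he' p' hp').symm (hd' p' hp').symm
    · exact iff_of_false (he' p hp) (hd' p hp)
    · exact hZ.inj p hp p' hp'

/-- A matching with fewer than `q` pairs uses equally many elements of each type on both sides, so
that an unused element of a type exists on one side if and only if it does on the other. -/
theorem Approximates.exists_fresh_iff (hD : Approximates ι D dom q) (hZ : IsMatching ι D dom Z)
    (hq : Z.card < q) (j : ℕ) :
    (∃ e ∈ dom, e.1 = j ∧ ∀ p ∈ Z, p.1 ≠ e) ↔
      ∃ d, ι (D.typeOf d) = j ∧ ∀ p ∈ Z, p.2 ≠ d := by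
  classical
  let Zj := Z.filter fun p => p.1.1 = j
  have hsub : ∀ p ∈ Zj, p ∈ Z := fun p hp => (Finset.mem_filter.1 hp).1
  have h1 : (Zj.image Prod.fst).card = Zj.card := Finset.card_image_of_injOn
    fun p hp p' hp' h => Prod.ext h ((hZ.inj p (hsub p hp) p' (hsub p' hp')).1 h)
  have h2 : (Zj.image Prod.snd).card = Zj.card := Finset.card_image_of_injOn
    fun p hp p' hp' h => Prod.ext ((hZ.inj p (hsub p hp) p' (hsub p' hp')).2 h) h
  have hs1 : (↑(Zj.image Prod.fst) : Set Elem) ⊆ {e | e ∈ dom ∧ e.1 = j} := by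
    intro e he
    obtain ⟨p, hp, rfl⟩ := Finset.mem_image.1 (Finset.mem_coe.1 he)
    exact ⟨hZ.mem p (hsub p hp), (Finset.mem_filter.1 hp).2⟩
  have hs2 : (↑(Zj.image Prod.snd) : Set D.Dom) ⊆ {d | ι (D.typeOf d) = j} := by
    intro d hd
    obtain ⟨p, hp, rfl⟩ := Finset.mem_image.1 (Finset.mem_coe.1 hd)
    exact (hZ.type p (hsub p hp)).trans (Finset.mem_filter.1 hp).2
  have key := hD.count j Zj.card ((Finset.card_filter_le _ _).trans_lt hq)
  nth_rw 1 [← h1] at key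
  rw [← h2, ← exists_mem_notMem_iff_card_lt_encard hs1,
    ← exists_mem_notMem_iff_card_lt_encard hs2] at key
  constructor
  · rintro ⟨e, he, hej, hfresh⟩
    obtain ⟨d, hd, hd'⟩ := key.1 ⟨e, ⟨he, hej⟩, fun h => by
      obtain ⟨p, hp, hpe⟩ := Finset.mem_image.1 h
      exact hfresh p (hsub p hp) hpe⟩
    refine ⟨d, hd, fun p hp hpd => hd' (Finset.mem_image.2 ⟨p, ?_, hpd⟩)⟩
    refine Finset.mem_filter.2 ⟨hp, ?_⟩
    rw [← hZ.type p hp, hpd]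
    exact hd
  · rintro ⟨d, hd, hfresh⟩
    obtain ⟨e, he, he'⟩ := key.2 ⟨d, hd, fun h => by
      obtain ⟨p, hp, hpd⟩ := Finset.mem_image.1 h
      exact hfresh p (hsub p hp) hpd⟩
    refine ⟨e, he.1, he.2, fun p hp hpe => he' (Finset.mem_image.2 ⟨p, ?_, hpe⟩)⟩
    exact Finset.mem_filter.2 ⟨hp, by rw [hpe]; exact he.2⟩

/-- The back-and-forth step for the quantifiers `∃` and, by negation, `∀`. -/
theorem Approximates.exists_iff [DecidableEq (Elem × D.Dom)] (hD : Approximates ι D dom q)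
    (hZ : IsMatching ι D dom Z)
    (hq : Z.card < q) {Q : Elem → Prop} {P : D.Dom → Prop}
    (hQP : ∀ e d, IsMatching ι D dom (insert (e, d) Z) → (Q e ↔ P d)) :
    (∃ e ∈ dom, Q e) ↔ ∃ d, P d := by
  constructor
  · rintro ⟨e, he, hQ⟩
    by_cases hfresh : ∀ p ∈ Z, p.1 ≠ e
    · obtain ⟨d, hd, hd'⟩ := (hD.exists_fresh_iff hZ hq e.1).1 ⟨e, he, rfl, hfresh⟩
      exact ⟨d, (hQP e d (hZ.insert he hd hfresh hd')).1 hQ⟩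
    · push Not at hfresh
      obtain ⟨p, hp, rfl⟩ := hfresh
      exact ⟨p.2, (hQP p.1 p.2 (by rwa [Finset.insert_eq_of_mem hp])).1 hQ⟩
  · rintro ⟨d, hP⟩
    by_cases hfresh : ∀ p ∈ Z, p.2 ≠ d
    · obtain ⟨e, he, hed, he'⟩ := (hD.exists_fresh_iff hZ hq _).2 ⟨d, rfl, hfresh⟩
      exact ⟨e, he, (hQP e d (hZ.insert he hed.symm he' hfresh)).2 hP⟩
    · push Not at hfresh
      obtain ⟨p, hp, rfl⟩ := hfresh
      exact ⟨p.1, hZ.mem p hp, (hQP p.1 p.2 (by rwa [Finset.insert_eq_of_mem hp])).2 hP⟩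

/-- The back-and-forth step for the infinity quantifiers: as there are finitely many types, an
infinite set has infinitely many elements of the same type. -/
theorem Approximates.exists_inf_iff [Finite A] [DecidableEq (Elem × D.Dom)]
    (hD : Approximates ι D dom q)
    (hZ : IsMatching ι D dom Z)
    (hq : Z.card < q) {Q : Elem → Prop} {P : D.Dom → Prop}
    (hQP : ∀ e d, IsMatching ι D dom (insert (e, d) Z) → (Q e ↔ P d)) :
    (∃ e ∈ dom, (e.2.1 = true ∧ ∀ p ∈ Z, p.1 ≠ e) ∧ Q e) ↔ {d | P d}.Infinite := by
  have hfin : {d | ∃ p ∈ Z, p.2 = d}.Finite :=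
    (Z.finite_toSet.image Prod.snd).subset fun d ⟨p, hp, h⟩ => ⟨p, hp, h⟩
  constructor
  · rintro ⟨e, he, ⟨hinf, hfresh⟩, hQ⟩
    refine (((hD.inf e he).1 hinf).sdiff hfin).mono ?_
    rintro d ⟨hd, hd'⟩
    exact (hQP e d (hZ.insert he hd hfresh fun p hp h => hd' ⟨p, hp, h⟩)).1 hQ
  · intro hP
    have : Infinite {d // P d} := hP.to_subtype
    obtain ⟨t, ht⟩ := Finite.exists_infinite_fiber fun d : {d // P d} => D.typeOf d.1
    have hPt : {d | P d ∧ D.typeOf d = t}.Infinite := by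
      refine (Set.infinite_coe_iff.1 ht |>.image Subtype.val_injective.injOn).mono ?_
      rintro _ ⟨d, hd, rfl⟩
      exact ⟨d.2, hd⟩
    obtain ⟨d, ⟨hPd, rfl⟩, hd'⟩ := hPt.exists_notMem_finite hfin
    have hd'' : ∀ p ∈ Z, p.2 ≠ d := fun p hp h => hd' ⟨p, hp, h⟩
    obtain ⟨e, he, hed, he'⟩ := (hD.exists_fresh_iff hZ hq _).2 ⟨d, rfl, hd''⟩
    refine ⟨e, he, ⟨(hD.inf e he).2 (hPt.mono ?_), he'⟩,
      (hQP e d (hZ.insert he hed.symm he' hd'')).2 hPd⟩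
    rintro d' ⟨-, h⟩
    simp [h, hed]

end Model

theorem code_lt_pair {t x m : ℕ} (ht : 0 < t) : m < Nat.pair t (Nat.pair x m) := by
  have := Nat.add_le_pair t (Nat.pair x m)
  have := Nat.add_le_pair x m
  omega

theorem code_lt_pair_left {t x m : ℕ} (ht : 0 < t) : x < Nat.pair t (Nat.pair x m) := by
  have := Nat.add_le_pair t (Nat.pair x m)
  have := Nat.add_le_pair x m
  omega

/-- The evaluator computes truth of `φ` if matching values are assigned to the free variables.
Gödel numbers decrease when passing to subformulas, so that the Gödel number of `φ` bounds the
number of pairs that are still to be added to the matching. -/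
theorem IsEvaluator.eval_iff_sat {A : Type v} [Finite A] [Encodable A] {tab : ℕ → ℕ → Bool}
    {f : EvalState → Bool} (hf : IsEvaluator tab f) {ι : Set A → ℕ}
    (htab : ∀ a t, tab (Encodable.encode a) (ι t) = true ↔ a ∈ t) {D : Model.{u} A}
    {dom : List Elem} {q : ℕ} (hD : Model.Approximates ι D dom q) (φ : Formula A) :
    ∀ (Z : Finset (Elem × D.Dom)) (env : List (ℕ × Elem)) (g : ℕ → D.Dom),
      Model.IsMatching ι D dom Z → Z.card + φ.code ≤ q →
      (∀ e, e ∈ env.map Prod.snd ↔ ∃ p ∈ Z, p.1 = e) →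
      (∀ x ∈ φ.freeVars, ∃ e, env.lookup x = some e ∧ (e, g x) ∈ Z) →
      (f (dom, φ.code, env) = true ↔ D.Sat g φ) := by
  classical
  -- The induction hypothesis for `φ`, applied after a value of `x` has been chosen on both sides.
  have step : ∀ (x : ℕ) (φ : Formula A) (Z : Finset (Elem × D.Dom)) (env : List (ℕ × Elem))
      (g : ℕ → D.Dom),
      (∀ (Z : Finset (Elem × D.Dom)) (env : List (ℕ × Elem)) (g : ℕ → D.Dom),
        Model.IsMatching ι D dom Z → Z.card + φ.code ≤ q →
        (∀ e, e ∈ env.map Prod.snd ↔ ∃ p ∈ Z, p.1 = e) →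
        (∀ x ∈ φ.freeVars, ∃ e, env.lookup x = some e ∧ (e, g x) ∈ Z) →
        (f (dom, φ.code, env) = true ↔ D.Sat g φ)) →
      Z.card + (φ.code + 1) ≤ q →
      (∀ e, e ∈ env.map Prod.snd ↔ ∃ p ∈ Z, p.1 = e) →
      (∀ y ∈ φ.freeVars.erase x, ∃ e, env.lookup y = some e ∧ (e, g y) ∈ Z) →
      ∀ e d, Model.IsMatching ι D dom (insert (e, d) Z) →
        (f (dom, φ.code, (x, e) :: env) = true ↔ D.Sat (Function.update g x d) φ) := by
    intro x φ Z env g ih hq henv hfv e d hZ'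
    refine ih _ _ _ hZ' ?_ ?_ ?_
    · have := Finset.card_insert_le (e, d) Z
      omega
    · intro e'
      simp [henv, eq_comm]
    · intro y hy
      by_cases hyx : y = x
      · subst hyx
        exact ⟨e, by simp, by simp⟩
      · obtain ⟨e', h1, h2⟩ := hfv y (Finset.mem_erase.2 ⟨hyx, hy⟩)
        refine ⟨e', ?_, by simp [Function.update_of_ne hyx, h2]⟩
        rw [List.lookup_cons, beq_false_of_ne hyx]
        exact h1
  have hcode : ∀ {t x m k : ℕ}, 0 < t → k + Nat.pair t (Nat.pair x m) ≤ q → k + (m + 1) ≤ q :=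
    fun {t x m k} ht h => by have := @code_lt_pair t x m ht; omega
  induction φ with
  | top => intro Z env g _ _ _ _; simp [hf.eval_top, Model.Sat]
  | bot => intro Z env g _ _ _ _; simp [hf.eval_bot, Model.Sat]
  | pred a x =>
    intro Z env g hZ _ _ hfv
    obtain ⟨e, he, hmem⟩ := hfv x (by simp [Formula.freeVars])
    rw [hf.eval_pred, he, Option.map_some, Option.getD_some, ← hZ.type _ hmem, htab]
    rfl
  | npred a x =>
    intro Z env g hZ _ _ hfv
    obtain ⟨e, he, hmem⟩ := hfv x (by simp [Formula.freeVars])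
    rw [hf.eval_npred, he, Option.map_some, Option.getD_some, ← hZ.type _ hmem,
      ← Bool.not_eq_true, htab]
    rfl
  | eq x y =>
    intro Z env g hZ _ _ hfv
    obtain ⟨e, he, hmem⟩ := hfv x (by simp [Formula.freeVars])
    obtain ⟨e', he', hmem'⟩ := hfv y (by simp [Formula.freeVars])
    rw [hf.eval_eq, he, he', Option.some_inj]
    exact hZ.inj _ hmem _ hmem'
  | neq x y =>
    intro Z env g hZ _ _ hfv
    obtain ⟨e, he, hmem⟩ := hfv x (by simp [Formula.freeVars])
    obtain ⟨e', he', hmem'⟩ := hfv y (by simp [Formula.freeVars])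
    rw [hf.eval_neq, he, he', Ne, Option.some_inj]
    exact not_congr (hZ.inj _ hmem _ hmem')
  | or φ ψ ih₁ ih₂ =>
    intro Z env g hZ hq henv hfv
    have h1 : φ.code < (φ.or ψ).code := code_lt_pair_left (by norm_num)
    have h2 : ψ.code < (φ.or ψ).code := code_lt_pair (by norm_num)
    rw [hf.eval_or, ih₁ Z env g hZ (by omega) henv fun x hx => hfv x (Finset.mem_union_left _ hx),
      ih₂ Z env g hZ (by omega) henv fun x hx => hfv x (Finset.mem_union_right _ hx)]
    rfl
  | and φ ψ ih₁ ih₂ =>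
    intro Z env g hZ hq henv hfv
    have h1 : φ.code < (φ.and ψ).code := code_lt_pair_left (by norm_num)
    have h2 : ψ.code < (φ.and ψ).code := code_lt_pair (by norm_num)
    rw [hf.eval_and, ih₁ Z env g hZ (by omega) henv fun x hx => hfv x (Finset.mem_union_left _ hx),
      ih₂ Z env g hZ (by omega) henv fun x hx => hfv x (Finset.mem_union_right _ hx)]
    rfl
  | ex x φ ih =>
    intro Z env g hZ hq henv hfv
    have hq' := hcode (by norm_num) hq
    rw [hf.eval_ex]
    exact hD.exists_iff hZ (by omega) (step x φ Z env g ih hq' henv hfv)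
  | all x φ ih =>
    intro Z env g hZ hq henv hfv
    have hq' := hcode (by norm_num) hq
    have := hD.exists_iff hZ (by omega)
      fun e d h => not_congr (step x φ Z env g ih hq' henv hfv e d h)
    rw [hf.eval_all]
    simpa only [not_exists, not_and, not_not, Model.Sat] using not_congr this
  | exInf x φ ih =>
    intro Z env g hZ hq henv hfv
    have hq' := hcode (by norm_num) hq
    rw [hf.eval_exInf]
    simp only [henv, not_exists, not_and]
    exact hD.exists_inf_iff hZ (by omega) (step x φ Z env g ih hq' henv hfv)
  | allInf x φ ih =>
    intro Z env g hZ hq henv hfv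
    have hq' := hcode (by norm_num) hq
    have := hD.exists_inf_iff hZ (by omega)
      fun e d h => not_congr (step x φ Z env g ih hq' henv hfv e d h)
    rw [hf.eval_allInf]
    simp only [henv, not_exists, not_and]
    have h2 := not_congr this
    rw [Set.not_infinite] at h2
    simp only [Model.Sat]
    rw [← h2]
    push Not
    rfl

theorem IsEvaluator.eval_nil_iff_trueInEmpty {A : Type v} [Encodable A] {tab : ℕ → ℕ → Bool}
    {f : EvalState → Bool} (hf : IsEvaluator tab f) (φ : Formula A) (hφ : φ.freeVars = ∅) :
    f ([], φ.code, []) = true ↔ φ.TrueInEmpty := by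
  induction φ with
  | top => simp [hf.eval_top, Formula.TrueInEmpty]
  | bot => simp [hf.eval_bot, Formula.TrueInEmpty]
  | pred | npred | eq | neq => simp [Formula.freeVars] at hφ
  | or φ ψ ih₁ ih₂ =>
    rw [Formula.freeVars, Finset.union_eq_empty] at hφ
    rw [hf.eval_or, ih₁ hφ.1, ih₂ hφ.2, Formula.TrueInEmpty]
  | and φ ψ ih₁ ih₂ =>
    rw [Formula.freeVars, Finset.union_eq_empty] at hφ
    rw [hf.eval_and, ih₁ hφ.1, ih₂ hφ.2, Formula.TrueInEmpty]
  | ex x φ => simp [hf.eval_ex, Formula.TrueInEmpty]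
  | all x φ => simp [hf.eval_all, Formula.TrueInEmpty]
  | exInf x φ => simp [hf.eval_exInf, Formula.TrueInEmpty]
  | allInf x φ => simp [hf.eval_allInf, Formula.TrueInEmpty]

theorem IsEvaluator.eval_iff_truth {A : Type v} [Finite A] [Encodable A] {tab : ℕ → ℕ → Bool}
    {f : EvalState → Bool} (hf : IsEvaluator tab f) {ι : Set A → ℕ}
    (htab : ∀ a t, tab (Encodable.encode a) (ι t) = true ↔ a ∈ t) {D : Model.{u} A}
    {dom : List Elem} {L : Logic} (φ : Sentence L A)
    (hD : Model.Approximates ι D dom (φ.code + 1)) :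
    f (dom, φ.code, []) = true ↔ D.Truth φ := by
  have hfv := φ.2.2
  rcases isEmpty_or_nonempty D.Dom with hE | hE
  · have hdom : dom = [] := by
      rw [List.eq_nil_iff_forall_not_mem]
      intro e he
      have := (hD.count e.1 0 (by omega)).1 (by
        rw [Nat.cast_zero, Set.encard_pos]
        exact ⟨e, he, rfl⟩)
      simp [Set.eq_empty_of_isEmpty] at this
    subst hdom
    refine (hf.eval_nil_iff_trueInEmpty φ.1 hfv).trans ?_
    simp [Model.Truth, hE]
  · have hsat : ∀ g, f (dom, φ.code, []) = true ↔ D.Sat g φ.1 := fun g =>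
      hf.eval_iff_sat htab hD φ.1 ∅ [] g ⟨by simp, by simp, by simp⟩
        (by simp [Sentence.code]) (by simp) (by simp [hfv])
    constructor
    · exact fun h => ⟨fun h' => absurd hE (not_nonempty_iff.2 h'), fun g => (hsat g).1 h⟩
    · exact fun h => (hsat fun _ => hE.some).2 (h.2 _)

/-! ### Invariance of sentences without equality -/

namespace Model

variable {A : Type v}

theorem sat_congr (D : Model.{u} A) (φ : Formula A) : ∀ {g g' : ℕ → D.Dom},
    (∀ x ∈ φ.freeVars, g x = g' x) → (D.Sat g φ ↔ D.Sat g' φ) := by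
  have step : ∀ (x : ℕ) (φ : Formula A) (g g' : ℕ → D.Dom),
      (∀ y ∈ φ.freeVars.erase x, g y = g' y) →
      ∀ d, ∀ y ∈ φ.freeVars, Function.update g x d y = Function.update g' x d y := by
    intro x φ g g' h d y hy
    by_cases hyx : y = x
    · simp [hyx]
    · simp [hyx, h y (Finset.mem_erase.2 ⟨hyx, hy⟩)]
  induction φ with
  | top | bot => intros; rfl
  | pred a x | npred a x => intro g g' h; simp [Sat, h x (by simp [Formula.freeVars])]
  | eq x y | neq x y =>
    intro g g' h
    simp [Sat, h x (by simp [Formula.freeVars]), h y (by simp [Formula.freeVars])]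
  | or φ ψ ih₁ ih₂ =>
    intro g g' h
    exact or_congr (ih₁ fun x hx => h x (Finset.mem_union_left _ hx))
      (ih₂ fun x hx => h x (Finset.mem_union_right _ hx))
  | and φ ψ ih₁ ih₂ =>
    intro g g' h
    exact and_congr (ih₁ fun x hx => h x (Finset.mem_union_left _ hx))
      (ih₂ fun x hx => h x (Finset.mem_union_right _ hx))
  | ex x φ ih => intro g g' h; exact exists_congr fun d => ih (step x φ g g' h d)
  | all x φ ih => intro g g' h; exact forall_congr' fun d => ih (step x φ g g' h d)
  | exInf x φ ih =>
    intro g g' h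
    simp only [Sat]
    simp_rw [fun d => ih (step x φ g g' h d)]
  | allInf x φ ih =>
    intro g g' h
    simp only [Sat]
    simp_rw [fun d => ih (step x φ g g' h d)]

theorem truth_iff_sat (D : Model.{u} A) {L : Logic} (φ : Sentence L A) (g : ℕ → D.Dom) :
    D.Truth φ ↔ D.Sat g φ.1 := by
  refine ⟨fun h => h.2 g, fun h => ⟨fun hE => (hE.false (g 0)).elim, fun g' => ?_⟩⟩
  exact (D.sat_congr φ.1 (by simp [φ.2.2])).1 h

theorem truth_iff_trueInEmpty (D : Model.{u} A) [hE : IsEmpty D.Dom] {L : Logic}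
    (φ : Sentence L A) : D.Truth φ ↔ φ.1.TrueInEmpty :=
  ⟨fun h => h.1 hE, fun h => ⟨fun _ => h, fun g => (hE.false (g 0)).elim⟩⟩

theorem sat_iff_of_isHom {D D' : Model.{u} A} {h : D.Dom → D'.Dom} (hh : IsHom D D' h)
    (hs : Function.Surjective h) (φ : Formula A) (hφ : φ.IsIn .M) :
    ∀ g : ℕ → D.Dom, D.Sat g φ ↔ D'.Sat (h ∘ g) φ := by
  induction φ with
  | top | bot => intro g; rfl
  | pred a x => intro g; exact hh a _
  | npred a x => intro g; exact not_congr (hh a _)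
  | eq | neq => exact hφ.elim
  | or φ ψ ih₁ ih₂ => intro g; exact or_congr (ih₁ hφ.1 g) (ih₂ hφ.2 g)
  | and φ ψ ih₁ ih₂ => intro g; exact and_congr (ih₁ hφ.1 g) (ih₂ hφ.2 g)
  | ex x φ ih =>
    intro g
    simp only [Sat, ih hφ, Function.comp_update, hs.exists]
  | all x φ ih =>
    intro g
    simp only [Sat, ih hφ, Function.comp_update, hs.forall]
  | exInf | allInf => exact hφ.1.elim

end Model

theorem Sentence.quotientInvariant_of_M {A : Type v} (ψ : Sentence .M A) :
    Sentence.QuotientInvariant.{u, v} ψ := by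
  rintro D D' ⟨h, hh, hs⟩
  rcases isEmpty_or_nonempty D.Dom with hE | ⟨⟨d⟩⟩
  · have : IsEmpty D'.Dom := ⟨fun d' => by
      obtain ⟨d, -⟩ := hs d'
      exact hE.false d⟩
    rw [D.truth_iff_trueInEmpty, D'.truth_iff_trueInEmpty]
  · rw [D.truth_iff_sat ψ fun _ => d, D'.truth_iff_sat ψ (h ∘ fun _ => d),
      Model.sat_iff_of_isHom hh hs ψ.1 ψ.2.1]

theorem Model.isQuotientOf_omegaProd {A : Type v} (D : Model.{u} A) :
    D.IsQuotientOf D.omegaProd :=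
  ⟨Prod.fst, fun _ _ => Iff.rfl, fun d => ⟨(d, 0), rfl⟩⟩

/-! ### Definability of sets of types -/

/-- The property `P` of models is expressed by a sentence of `M(A)`. As formulas are in negation
normal form, a sentence for the negation of `P` is part of the data. -/
def MDefinable {A : Type v} (P : Model.{u} A → Prop) : Prop :=
  ∃ ψ ψ' : Sentence .M A, ∀ D : Model.{u} A, (D.Truth ψ ↔ P D) ∧ (D.Truth ψ' ↔ ¬ P D)

/-- The property `P` of elements of models is expressed by a formula of `M(A)` in the variable `0`,
and so is its negation. -/
def MDefinableAt {A : Type v} (P : (D : Model.{u} A) → D.Dom → Prop) : Prop :=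
  ∃ χ χ' : Formula A, (χ.IsIn .M ∧ χ'.IsIn .M) ∧ (χ.freeVars ⊆ {0} ∧ χ'.freeVars ⊆ {0}) ∧
    ∀ (D : Model.{u} A) (g : ℕ → D.Dom), (D.Sat g χ ↔ P D (g 0)) ∧ (D.Sat g χ' ↔ ¬ P D (g 0))

section Definability

variable {A : Type v}

/-- Definability by sentences, with the empty model treated separately. -/
theorem MDefinable.of_truth_congr {P : Model.{u} A → Prop} (ψ ψ' : Formula A)
    (hψ : ψ.IsIn .M ∧ ψ.freeVars = ∅) (hψ' : ψ'.IsIn .M ∧ ψ'.freeVars = ∅)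
    (hempty : ∀ D : Model.{u} A, IsEmpty D.Dom →
      (ψ.TrueInEmpty ↔ P D) ∧ (ψ'.TrueInEmpty ↔ ¬ P D))
    (hsat : ∀ (D : Model.{u} A) (g : ℕ → D.Dom), (D.Sat g ψ ↔ P D) ∧ (D.Sat g ψ' ↔ ¬ P D)) :
    MDefinable P := by
  refine ⟨⟨ψ, hψ⟩, ⟨ψ', hψ'⟩, fun D => ?_⟩
  rcases isEmpty_or_nonempty D.Dom with hE | ⟨⟨d⟩⟩
  · exact ⟨(D.truth_iff_trueInEmpty _).trans (hempty D hE).1,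
      (D.truth_iff_trueInEmpty _).trans (hempty D hE).2⟩
  · exact ⟨(D.truth_iff_sat _ fun _ => d).trans (hsat D _).1,
      (D.truth_iff_sat _ fun _ => d).trans (hsat D _).2⟩

theorem MDefinable.true : MDefinable fun _ : Model.{u} A => True :=
  .of_truth_congr .top .bot ⟨trivial, rfl⟩ ⟨trivial, rfl⟩
    (fun _ _ => by simp [Formula.TrueInEmpty]) (fun _ _ => by simp [Model.Sat])

theorem MDefinable.not {P : Model.{u} A → Prop} (h : MDefinable P) :
    MDefinable fun D => ¬ P D := by
  obtain ⟨ψ, ψ', h⟩ := h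
  exact ⟨ψ', ψ, fun D => ⟨(h D).2, by rw [not_not]; exact (h D).1⟩⟩

theorem MDefinable.and {P Q : Model.{u} A → Prop} (hP : MDefinable P) (hQ : MDefinable Q) :
    MDefinable fun D => P D ∧ Q D := by
  obtain ⟨ψ, ψ', h⟩ := hP
  obtain ⟨χ, χ', h'⟩ := hQ
  refine .of_truth_congr (.and ψ.1 χ.1) (.or ψ'.1 χ'.1) ⟨⟨ψ.2.1, χ.2.1⟩, ?_⟩
    ⟨⟨ψ'.2.1, χ'.2.1⟩, ?_⟩ (fun D hE => ?_) fun D g => ?_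
  · simp [Formula.freeVars, ψ.2.2, χ.2.2]
  · simp [Formula.freeVars, ψ'.2.2, χ'.2.2]
  · have h := h D
    have h' := h' D
    rw [D.truth_iff_trueInEmpty, D.truth_iff_trueInEmpty] at h h'
    simp only [Formula.TrueInEmpty]
    tauto
  · have h := h D
    have h' := h' D
    rw [D.truth_iff_sat _ g, D.truth_iff_sat _ g] at h h'
    simp only [Model.Sat]
    tauto

theorem MDefinable.forall {ι : Type*} [Finite ι] {P : ι → Model.{u} A → Prop}
    (h : ∀ i, MDefinable (P i)) : MDefinable fun D => ∀ i, P i D := by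
  classical
  have := Fintype.ofFinite ι
  suffices ∀ s : Finset ι, MDefinable fun D => ∀ i ∈ s, P i D by simpa using this Finset.univ
  intro s
  induction s using Finset.induction_on with
  | empty => simpa using MDefinable.true
  | insert i s _ ih => simpa using (h i).and ih

theorem MDefinableAt.forall {ι : Type*} [Finite ι] {P : ι → (D : Model.{u} A) → D.Dom → Prop}
    (h : ∀ i, MDefinableAt (P i)) : MDefinableAt fun D d => ∀ i, P i D d := by
  classical
  have := Fintype.ofFinite ι
  suffices ∀ s : Finset ι, MDefinableAt fun (D : Model.{u} A) d => ∀ i ∈ s, P i D d by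
    simpa using this Finset.univ
  intro s
  induction s using Finset.induction_on with
  | empty =>
    exact ⟨.top, .bot, ⟨trivial, trivial⟩, by simp [Formula.freeVars], by simp [Model.Sat]⟩
  | insert i s _ ih =>
    obtain ⟨χ₁, χ₁', hM₁, hfv₁, h₁⟩ := h i
    obtain ⟨χ₂, χ₂', hM₂, hfv₂, h₂⟩ := ih
    refine ⟨.and χ₁ χ₂, .or χ₁' χ₂', ⟨⟨hM₁.1, hM₂.1⟩, ⟨hM₁.2, hM₂.2⟩⟩,
      ⟨Finset.union_subset hfv₁.1 hfv₂.1, Finset.union_subset hfv₁.2 hfv₂.2⟩, fun D g => ?_⟩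
    simp only [Model.Sat, h₁ D g, h₂ D g, Finset.forall_mem_insert]
    tauto

theorem MDefinableAt.exists {P : (D : Model.{u} A) → D.Dom → Prop} (h : MDefinableAt P) :
    MDefinable fun D => ∃ d, P D d := by
  obtain ⟨χ, χ', hM, hfv, h⟩ := h
  refine .of_truth_congr (.ex 0 χ) (.all 0 χ') ⟨hM.1, ?_⟩ ⟨hM.2, ?_⟩ (fun D hE => ?_)
    fun D g => ?_
  · simpa [Formula.freeVars, Finset.erase_eq_empty_iff, Finset.subset_singleton_iff] using hfv.1
  · simpa [Formula.freeVars, Finset.erase_eq_empty_iff, Finset.subset_singleton_iff] using hfv.2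
  · simp [Formula.TrueInEmpty]
  · simp [Model.Sat, h]

theorem MDefinableAt.typeOf_eq [Finite A] (t : Set A) :
    MDefinableAt fun (D : Model.{u} A) d => D.typeOf d = t := by
  classical
  simp only [Set.ext_iff]
  refine MDefinableAt.forall fun a => ?_
  by_cases ha : a ∈ t
  · exact ⟨.pred a 0, .npred a 0, ⟨trivial, trivial⟩, by simp [Formula.freeVars],
      fun D g => by simp [Model.Sat, Model.typeOf, ha]⟩
  · exact ⟨.npred a 0, .pred a 0, ⟨trivial, trivial⟩, by simp [Formula.freeVars],
      fun D g => by simp [Model.Sat, Model.typeOf, ha]⟩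

/-- The set of the types that are realised in a model. -/
def Model.support (D : Model.{u} A) : Set (Set A) := {t | ∃ d, D.typeOf d = t}

theorem mDefinable_support_mem [Finite A] (B : Set (Set (Set A))) :
    MDefinable fun D : Model.{u} A => D.support ∈ B := by
  have h1 : ∀ S : Set (Set A), MDefinable fun D : Model.{u} A => D.support = S := by
    intro S
    simp only [Set.ext_iff]
    refine .forall fun t => ?_
    have ht : MDefinable fun D : Model.{u} A => t ∈ D.support :=
      (MDefinableAt.typeOf_eq t).exists
    by_cases hS : t ∈ S
    · simpa [hS] using ht
    · simpa [hS] using ht.not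
  have h3 : MDefinable fun D : Model.{u} A => ∀ S : ↥Bᶜ, ¬ D.support = S.1 :=
    .forall fun S => (h1 S.1).not
  have h4 : ∀ D : Model.{u} A, (∀ S : ↥Bᶜ, ¬ D.support = S.1) ↔ D.support ∈ B := by
    intro D
    constructor
    · intro h
      by_contra hB
      exact h ⟨_, hB⟩ rfl
    · rintro hB ⟨S, hS⟩ rfl
      exact hS hB
  simpa only [h4] using h3

end Definability

/-! ### Profiles -/

/-- The finite domain with `v j` elements of the type number `j`. They are flagged as belonging to
an infinite type if `v j = q + 1`. -/
def profileDom (q : ℕ) (v : List ℕ) : List Elem :=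
  (List.range v.length).flatMap fun j =>
    (List.range (v.getD j 0)).map fun k => (j, decide (v.getD j 0 = q + 1), k)

theorem mem_profileDom {q : ℕ} {v : List ℕ} {e : Elem} :
    e ∈ profileDom q v ↔ e.2.2 < v.getD e.1 0 ∧ e.2.1 = decide (v.getD e.1 0 = q + 1) := by
  obtain ⟨j, b, k⟩ := e
  have hj : k < v.getD j 0 → j < v.length := by
    intro h
    by_contra hj
    rw [List.getD_eq_default _ _ (not_lt.1 hj)] at h
    omega
  simp only [profileDom, List.mem_flatMap, List.mem_range, List.mem_map, Prod.mk.injEq]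
  constructor
  · rintro ⟨j, _, k, hk, rfl, rfl, rfl⟩
    exact ⟨hk, rfl⟩
  · rintro ⟨hk, hb⟩
    exact ⟨j, hj hk, k, hk, rfl, hb.symm, rfl⟩

theorem encard_profileDom (q : ℕ) (v : List ℕ) (j : ℕ) :
    {e | e ∈ profileDom q v ∧ e.1 = j}.encard = v.getD j 0 := by
  have : {e | e ∈ profileDom q v ∧ e.1 = j} =
      (fun k => ((j, decide (v.getD j 0 = q + 1), k) : Elem)) ''
        (Finset.range (v.getD j 0) : Set ℕ) := by
    ext ⟨j', b, k⟩
    simp only [Set.mem_ofPred_eq, mem_profileDom, Set.mem_image, Finset.coe_range, Set.mem_Iio,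
      Prod.mk.injEq]
    constructor
    · rintro ⟨⟨h1, hb⟩, rfl⟩
      exact ⟨k, h1, rfl, hb.symm, rfl⟩
    · rintro ⟨k, hk, rfl, rfl, rfl⟩
      exact ⟨⟨hk, rfl⟩, rfl⟩
  rw [this, Function.Injective.encard_image (fun k k' h => by simpa using h),
    Set.encard_coe_eq_coe_finsetCard, Finset.card_range]

open Primrec in
theorem primrec_profileDom : Primrec₂ profileDom := by
  have hval : Primrec₂ fun (p : ℕ × List ℕ) (j : ℕ) => p.2.getD j 0 :=
    (list_getD 0).comp (snd.comp fst) snd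
  have hflag : Primrec₂ fun (p : ℕ × List ℕ) (j : ℕ) => decide (p.2.getD j 0 = p.1 + 1) :=
    (Primrec.eq.comp hval (succ.comp (fst.comp fst))).decide
  exact list_flatMap (list_range.comp (list_length.comp snd))
    (list_map (list_range.comp hval)
      (pair (snd.comp fst) (pair (hflag.comp (fst.comp fst) (snd.comp fst)) snd)))

namespace Model

variable {A : Type v}

open Classical in
/-- The number of elements of type `t` in a model, cut down to `q` if it is finite, and `q + 1` if
it is infinite. -/
noncomputable def multiplicity (D : Model.{u} A) (q : ℕ) (t : Set A) : ℕ :=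
  if {d | D.typeOf d = t}.Infinite then q + 1 else min {d | D.typeOf d = t}.ncard q

/-- The list of the multiplicities of all types. -/
noncomputable def profile (D : Model.{u} A) {m : ℕ} (e : Set A ≃ Fin m) (q : ℕ) : List ℕ :=
  List.ofFn fun j => D.multiplicity q (e.symm j)

variable (D : Model.{u} A) {m : ℕ} (e : Set A ≃ Fin m) (q : ℕ)

theorem profile_getD (t : Set A) : (D.profile e q).getD (e t) 0 = D.multiplicity q t := by
  simp [profile, List.getD_eq_getElem?_getD]

theorem approximates_profile :
    Approximates (fun t => (e t : ℕ)) D (profileDom q (D.profile e q)) q where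
  count := by
    intro j u hu
    rw [encard_profileDom]
    by_cases hj : j < m
    · obtain ⟨t, rfl⟩ : ∃ t, j = e t := ⟨e.symm ⟨j, hj⟩, by simp⟩
      simp only [Fin.val_inj, EmbeddingLike.apply_eq_iff_eq]
      rw [profile_getD, multiplicity]
      split_ifs with h
      · rw [h.encard_eq]
        simp only [Nat.cast_lt, ENat.natCast_lt_top, iff_true]
        omega
      · rw [← (Set.not_infinite.1 h).cast_ncard_eq]
        simp only [Nat.cast_lt]
        omega
    · have h1 : (D.profile e q).getD j 0 = 0 :=
        List.getD_eq_default _ _ (by simpa [profile] using hj)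
      have h2 : {d | (e (D.typeOf d) : ℕ) = j} = ∅ := by
        ext d
        simp only [Set.mem_ofPred_eq, Set.mem_empty_iff_false, iff_false]
        rintro rfl
        exact hj (e _).2
      rw [h1, h2]
      simp
  inf := by
    intro x hx
    obtain ⟨h1, h2⟩ := mem_profileDom.1 hx
    have hj : x.1 < m := by
      by_contra hj
      rw [List.getD_eq_default _ _ (by simpa [profile] using hj)] at h1
      omega
    obtain ⟨t, ht⟩ : ∃ t, x.1 = e t := ⟨e.symm ⟨x.1, hj⟩, by simp⟩
    rw [h2, ht, profile_getD, multiplicity]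
    simp only [Fin.val_inj, EmbeddingLike.apply_eq_iff_eq, decide_eq_true_eq]
    split_ifs with h
    · simpa using h
    · simp only [h, iff_false]
      omega

/-- The profile of the `ω`-product of a model with profile `v`. -/
def blowUp (q : ℕ) (v : List ℕ) : List ℕ := v.map fun x => if x = 0 then 0 else q + 1

open Classical in
theorem multiplicity_omegaProd (t : Set A) :
    D.omegaProd.multiplicity q t = if t ∈ D.support then q + 1 else 0 := by
  unfold multiplicity
  split_ifs with h1 h2 h2
  · rfl
  · obtain ⟨x, hx⟩ := Set.Infinite.nonempty h1
    exact absurd ⟨x.1, hx⟩ h2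
  · obtain ⟨d, hd⟩ := h2
    refine absurd ?_ h1
    refine (Set.infinite_range_of_injective (Prod.mk_right_injective d)).mono ?_
    rintro _ ⟨k, rfl⟩
    exact hd
  · have : {d | D.omegaProd.typeOf d = t} = ∅ := by
      ext x
      simp only [Set.mem_ofPred_eq, Set.mem_empty_iff_false, iff_false]
      exact fun hx => h2 ⟨x.1, hx⟩
    simp [this]

theorem multiplicity_eq_zero_iff {t : Set A} (hq : 0 < q) :
    D.multiplicity q t = 0 ↔ t ∉ D.support := by
  unfold multiplicity
  split_ifs with h
  · obtain ⟨d, hd⟩ := h.nonempty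
    exact iff_of_false id (not_not.2 ⟨d, hd⟩)
  · have := Set.ncard_eq_zero (Set.not_infinite.1 h)
    rw [Nat.min_eq_zero_iff, this, Set.eq_empty_iff_forall_notMem]
    simp [support, hq.ne']

theorem profile_omegaProd (hq : 0 < q) :
    D.omegaProd.profile e q = blowUp q (D.profile e q) := by
  simp only [profile, blowUp, List.map_ofFn]
  congr 1
  funext j
  by_cases h : e.symm j ∈ D.support <;>
    simp [multiplicity_omegaProd, multiplicity_eq_zero_iff D q hq, h]

theorem multiplicity_lt (t : Set A) : D.multiplicity q t < q + 2 := by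
  unfold multiplicity
  split_ifs <;> omega

end Model

/-- The lists of length `m` with entries smaller than `b`. -/
def boundedLists : ℕ → ℕ → List (List ℕ)
  | 0, _ => [[]]
  | m + 1, b => (boundedLists m b).flatMap fun v => (List.range b).map fun x => x :: v

theorem mem_boundedLists {m b : ℕ} {v : List ℕ} :
    v ∈ boundedLists m b ↔ v.length = m ∧ ∀ x ∈ v, x < b := by
  induction m generalizing v with
  | zero => simp +contextual [boundedLists, List.length_eq_zero_iff]
  | succ m ih =>
    cases v with
    | nil => simp [boundedLists]
    | cons x v => simp [boundedLists, ih]; tauto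

open Primrec in
theorem primrec_boundedLists (m : ℕ) : Primrec (boundedLists m) := by
  induction m with
  | zero => exact const _
  | succ m ih =>
    exact list_flatMap ih (list_map (list_range.comp fst) (list_cons.comp snd (snd.comp fst)))

/-- Every list with admissible entries is the profile of a model. -/
theorem Model.exists_profile_eq {A : Type v} {m : ℕ} (e : Set A ≃ Fin m) (q : ℕ) {v : List ℕ}
    (hv : v ∈ boundedLists m (q + 2)) : ∃ D : Model.{u} A, D.profile e q = v := by
  obtain ⟨rfl, hb⟩ := mem_boundedLists.1 hv
  let D : Model.{u} A :=
    { Dom := ULift.{u} (Σ j : Fin v.length, {k : ℕ // v[j] = q + 1 ∨ k < v[j]})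
      val := fun a => {x | a ∈ e.symm x.down.1} }
  refine ⟨D, List.ext_getElem (by simp [Model.profile]) fun j h1 h2 => ?_⟩
  simp only [Model.profile, List.getElem_ofFn]
  have hset : {d | D.typeOf d = e.symm ⟨j, h2⟩} = Set.range
      fun k : {k : ℕ // v[j] = q + 1 ∨ k < v[j]} => (ULift.up ⟨⟨j, h2⟩, k⟩ : D.Dom) := by
    ext ⟨⟨i, k⟩⟩
    have : D.typeOf ⟨⟨i, k⟩⟩ = e.symm i := rfl
    simp only [Set.mem_ofPred_eq, this, EmbeddingLike.apply_eq_iff_eq, Set.mem_range]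
    constructor
    · rintro rfl
      exact ⟨k, rfl⟩
    · rintro ⟨k', h⟩
      exact (congrArg Sigma.fst (ULift.up_injective h)).symm
  have hinj : Function.Injective
      fun k : {k : ℕ // v[j] = q + 1 ∨ k < v[j]} => (ULift.up ⟨⟨j, h2⟩, k⟩ : D.Dom) :=
    fun k k' h => by simpa using ULift.up_injective h
  unfold Model.multiplicity
  rw [hset]
  have hlt := hb _ (List.getElem_mem h2)
  by_cases hj : v[j] = q + 1
  · have : Infinite {k : ℕ // v[j] = q + 1 ∨ k < v[j]} := by
      simp only [hj, true_or]
      exact (Equiv.subtypeUnivEquiv fun _ : ℕ => trivial).infinite_iff.2 inferInstance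
    rw [if_pos (Set.infinite_range_of_injective hinj), hj]
  · have hcard : Nat.card {k : ℕ // v[j] = q + 1 ∨ k < v[j]} = v[j] := by
      simp only [hj, false_or]
      exact (Nat.subtype_card (Finset.range v[j]) (by simp)).trans (Finset.card_range _)
    have : Finite {k : ℕ // v[j] = q + 1 ∨ k < v[j]} := by
      simp only [hj, false_or]
      exact (Set.finite_Iio v[j]).to_subtype
    rw [if_neg (Set.not_infinite.2 (Set.finite_range _)), ← Nat.card_coe_set_eq,
      Nat.card_range_of_injective hinj, hcard]
    omega

/-! ### Translation and decidability -/

theorem primrecPred_mem_finite {α : Type*} [Primcodable α] {S : Set α} (hS : S.Finite) :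
    PrimrecPred fun x => x ∈ S :=
  PrimrecPred.of_eq (p := fun x => ∃ y ∈ hS.toFinset.toList, y = x)
    ((PrimrecRel.exists_mem_list Primrec.eq).comp (Primrec.const _) Primrec.id) fun x => by simp

/-- A number that depends only on finitely many primitive recursive truth values is primitive
recursive, no matter how it depends on them. -/
theorem primrec_of_finite_family {ι : Type*} [Finite ι] {g : ι → ℕ → Bool}
    (hg : ∀ i, Primrec (g i)) (H : (ι → Bool) → ℕ) : Primrec fun n => H fun i => g i n := by
  obtain ⟨k, ⟨e⟩⟩ := Finite.exists_equiv_fin ι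
  refine ((Primrec.dom_finite fun w : List.Vector Bool k => H fun i => w.get (e i)).comp
    (Primrec.vector_ofFn fun j => hg (e.symm j))).of_eq fun n => ?_
  simp

/-- The truth value of a sentence in a model is a primitive recursive function of the Gödel number
of the sentence and the profile of the model. -/
theorem exists_evaluator (A : Type v) [Finite A] [Encodable A] :
    ∃ (m : ℕ) (e : Set A ≃ Fin m) (f : EvalState → Bool), Primrec f ∧
      ∀ (L : Logic) (φ : Sentence L A) (D : Model.{u} A),
        f (profileDom (φ.code + 1) (D.profile e (φ.code + 1)), φ.code, []) = true ↔
          D.Truth φ := by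
  classical
  obtain ⟨m, ⟨e⟩⟩ := Finite.exists_equiv_fin (Set A)
  let S : Set (ℕ × ℕ) :=
    (fun p : A × Set A => (Encodable.encode p.1, (e p.2 : ℕ))) '' {p | p.1 ∈ p.2}
  let tab : ℕ → ℕ → Bool := fun c j => decide ((c, j) ∈ S)
  have htab : Primrec₂ tab := (primrecPred_mem_finite ((Set.toFinite _).image _)).decide
  have htab' : ∀ a t, tab (Encodable.encode a) (e t) = true ↔ a ∈ t := by
    intro a t
    simp only [tab, decide_eq_true_eq]
    constructor
    · rintro ⟨⟨a', t'⟩, h, heq⟩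
      simp only [Prod.mk.injEq, Encodable.encode_inj, Fin.val_inj,
        EmbeddingLike.apply_eq_iff_eq] at heq
      obtain ⟨rfl, rfl⟩ := heq
      exact h
    · exact fun h => ⟨(a, t), h, rfl⟩
  obtain ⟨f, hf⟩ := exists_isEvaluator htab
  exact ⟨m, e, f, hf.primrec, fun L φ D =>
    hf.eval_iff_truth htab' φ (D.approximates_profile e _)⟩

open Primrec in
/-- The translation: `φ` holds in the `ω`-product of a model with the set `S` of realised types if
and only if the evaluator accepts `φ` on the profile in which exactly the types in `S` are infinite. -/
theorem exists_translation (A : Type v) [Finite A] [Encodable A] (L : Logic) :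
    ∃ t : Sentence L A → Sentence .M A, Effective t ∧
      ∀ (φ : Sentence L A) (D : Model.{u} A), D.Truth (t φ) ↔ D.omegaProd.Truth φ := by
  classical
  obtain ⟨m, e, f, hf, hspec⟩ := exists_evaluator.{u, v} A
  let pr : Set (Set A) → ℕ → List ℕ := fun S q =>
    List.ofFn fun j : Fin m => if e.symm j ∈ S then q + 1 else 0
  let g : Set (Set A) → ℕ → Bool := fun S n => f (profileDom (n + 1) (pr S (n + 1)), n, [])
  have hpr : ∀ S, Primrec (pr S) := fun S => list_ofFn fun j => by
    split_ifs
    exacts [succ, const 0]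
  have hg : ∀ S, Primrec (g S) := fun S =>
    hf.comp (pair (primrec_profileDom.comp succ ((hpr S).comp succ)) (pair Primrec.id (const [])))
  choose ψ _ hψ using fun B : Set (Set A) → Bool =>
    mDefinable_support_mem.{u, v} (A := A) {S | B S = true}
  refine ⟨fun φ => ψ fun S => g S φ.code,
    ⟨_, (primrec_of_finite_family hg fun B => (ψ B).code).to_comp, fun φ => rfl⟩, fun φ D => ?_⟩
  rw [(hψ _ D).1, ← hspec L φ D.omegaProd]
  have : D.omegaProd.profile e (φ.code + 1) = pr D.support (φ.code + 1) := by
    simp only [Model.profile, pr, Model.multiplicity_omegaProd]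
  rw [this]
  rfl

theorem Sentence.quotientInvariant_congr {A : Type v} {L L' : Logic} {φ : Sentence L A}
    {ψ : Sentence L' A} (h : Sentence.Equivalent.{u, v} φ ψ)
    (hψ : Sentence.QuotientInvariant.{u, v} ψ) : Sentence.QuotientInvariant.{u, v} φ :=
  fun D D' hq => by rw [h D, h D', hψ D D' hq]

/-- If a model and its `ω`-product always agree on `φ`, then `φ` is equivalent to its translation,
a sentence of `M(A)`, and therefore invariant. -/
theorem Sentence.quotientInvariant_iff {A : Type v} [Finite A] [Encodable A] {L : Logic}
    (φ : Sentence L A) :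
    Sentence.QuotientInvariant.{u, v} φ ↔
      ∀ D : Model.{u} A, D.Truth φ ↔ D.omegaProd.Truth φ := by
  refine ⟨fun h D => (h _ _ D.isQuotientOf_omegaProd).symm, fun h => ?_⟩
  obtain ⟨t, -, ht⟩ := exists_translation.{u, v} A L
  exact quotientInvariant_congr (fun D => (h D).trans (ht φ D).symm) (quotientInvariant_of_M (t φ))

open Primrec in
theorem decidableProperty_quotientInvariant (A : Type v) [Finite A] [Encodable A] (L : Logic) :
    DecidableProperty fun φ : Sentence L A => Sentence.QuotientInvariant.{u, v} φ := by
  classical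
  obtain ⟨m, e, f, hf, hspec⟩ := exists_evaluator.{u, v} A
  obtain ⟨c, hc, hcheck⟩ := exists_primrec_check L A
  have hblow : Primrec₂ Model.blowUp :=
    list_map snd (ite (Primrec.eq.comp snd (const 0)) (const 0) (succ.comp (fst.comp fst)))
  have heval : ∀ {w : List ℕ → ℕ → List ℕ}, Primrec₂ w → Primrec₂ fun (v : List ℕ) (n : ℕ) =>
      f (profileDom (n + 1) (w v n), n, []) := fun hw =>
    hf.comp (pair (primrec_profileDom.comp (succ.comp snd) hw) (pair snd (const [])))
  have hrel : PrimrecRel fun (v : List ℕ) (n : ℕ) =>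
      f (profileDom (n + 1) v, n, []) =
        f (profileDom (n + 1) (Model.blowUp (n + 1) v), n, []) :=
    Primrec.eq.comp (heval (w := fun v _ => v) fst)
      (heval (w := fun v n => Model.blowUp (n + 1) v) (hblow.comp (succ.comp snd) fst))
  have hall : PrimrecPred fun n : ℕ => ∀ v ∈ boundedLists m (n + 3),
      f (profileDom (n + 1) v, n, []) =
        f (profileDom (n + 1) (Model.blowUp (n + 1) v), n, []) :=
    hrel.forall_mem_list.comp ((primrec_boundedLists m).comp (nat_add.comp Primrec.id (const 3)))
      Primrec.id
  have hcode : PrimrecPred fun n : ℕ => c (n, []) = true :=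
    Primrec.eq.comp (hc.comp (pair Primrec.id (const []))) (const true)
  have hpred := hcode.and hall
  -- Every list in `boundedLists` is a profile, so the bounded search covers all models.
  have key : ∀ φ : Sentence L A, Sentence.QuotientInvariant.{u, v} φ ↔
      ∀ v ∈ boundedLists m (φ.code + 3), f (profileDom (φ.code + 1) v, φ.code, []) =
        f (profileDom (φ.code + 1) (Model.blowUp (φ.code + 1) v), φ.code, []) := by
    intro φ
    rw [Sentence.quotientInvariant_iff]
    simp only [← hspec L φ, Model.profile_omegaProd _ e _ (Nat.succ_pos _)]
    constructor
    · intro h v hv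
      obtain ⟨D, rfl⟩ := Model.exists_profile_eq.{u, v} e (φ.code + 1) hv
      exact Bool.eq_iff_iff.2 (h D)
    · intro h D
      refine Bool.eq_iff_iff.1 (h _ (mem_boundedLists.2 ⟨by simp [Model.profile], ?_⟩))
      intro x hx
      obtain ⟨j, rfl⟩ := (List.mem_ofFn' _ _).1 hx
      exact D.multiplicity_lt _ _
  refine (hpred.computablePred).of_eq fun n => ?_
  rw [hcheck]
  constructor
  · rintro ⟨⟨φ, rfl, hL, hfv⟩, h⟩
    let φ' : Sentence L A := ⟨φ, hL, by simpa using hfv⟩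
    exact ⟨φ', rfl, (key φ').2 h⟩
  · rintro ⟨φ, rfl, h⟩
    exact ⟨⟨φ.1, rfl, φ.2.1, by simp [φ.2.2]⟩, (key φ).1 h⟩

end MonadicLogic

theorem theoremt (A : Type v) [Finite A] [Encodable A] (L : MonadicLogic.Logic)
    (hL : L = MonadicLogic.Logic.FOE ∨ L = MonadicLogic.Logic.FOEinf) :
    (∀ φ : MonadicLogic.Sentence L A,
      MonadicLogic.Sentence.QuotientInvariant.{u, v} φ ↔
        ∃ ψ : MonadicLogic.Sentence MonadicLogic.Logic.M A,
          MonadicLogic.Sentence.Equivalent.{u, v} φ ψ) ∧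
    (∃ t : MonadicLogic.Sentence L A → MonadicLogic.Sentence MonadicLogic.Logic.M A,
      MonadicLogic.Effective t ∧
      (∀ (φ : MonadicLogic.Sentence L A) (D : MonadicLogic.Model.{u, v} A),
        D.Truth (t φ) ↔ D.omegaProd.Truth φ) ∧
      (∀ φ : MonadicLogic.Sentence L A,
        MonadicLogic.Sentence.QuotientInvariant.{u, v} φ ↔
          MonadicLogic.Sentence.Equivalent.{u, v} φ (t φ))) ∧
    MonadicLogic.DecidableProperty
      (fun φ : MonadicLogic.Sentence L A =>
        MonadicLogic.Sentence.QuotientInvariant.{u, v} φ) := by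
  obtain ⟨t, hteff, ht⟩ := MonadicLogic.exists_translation.{u, v} A L
  have hinv : ∀ φ : MonadicLogic.Sentence L A,
      MonadicLogic.Sentence.QuotientInvariant.{u, v} φ ↔
        MonadicLogic.Sentence.Equivalent.{u, v} φ (t φ) := fun φ => by
    rw [MonadicLogic.Sentence.quotientInvariant_iff]
    exact forall_congr' fun D => by rw [ht φ D]
  refine ⟨fun φ => ⟨fun h => ⟨t φ, (hinv φ).1 h⟩, ?_⟩, ⟨t, hteff, ht, hinv⟩,
    MonadicLogic.decidableProperty_quotientInvariant A L⟩
  rintro ⟨ψ, hψ⟩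
  exact MonadicLogic.Sentence.quotientInvariant_congr hψ
    (MonadicLogic.Sentence.quotientInvariant_of_M ψ)
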